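/- Let $X$ be a compact metrizable space and let $n\ge 0$ be an integer with $\dim X\le n$, where $\dim$ is the covering dimension; for an integer $k<0$, "$\dim Y\le k$" means $Y=\emptyset$. Let $C(X,\mathbb R^m)$ be the space of all continuous maps $X\to\mathbb R^m$ with the topology of uniform convergence. Let $M_{m,d}$ be the space of all $d$-dimensional affine subspaces ($d$-planes) of $\mathbb R^m$ with its usual topology, i.e. the one given by the metric $$\rho(\Pi,\Pi')=\max\{\|P_\Pi-P_{\Pi'}\|,\ \|a_\Pi-a_{\Pi'}\|\},$$ where $P_\Pi$ is the orthogonal projection of $\mathbb R^m$ onto the linear subspace parallel to $\Pi$ and $a_\Pi$ is the point of $\Pi$ closest to the origin. For integers $q\geq 1$, $0\le d\le m$, $k$ and a map $g\in C(X,\mathbb R^m)$ put $$B_{q,d,m}(g)=\{\Pi\in M_{m,d} : |g^{-1}(\Pi)|\ge q\},$$ considered as a subspace of $M_{m,d}$, and $$\mathcal H(q,d,m,k)=\{g\in C(X,\mathbb R^m) : \dim B_{q,d,m}(g)\le k\}.$$ Then: (a) $\mathcal H(3,1,m,3n+1-m)$ is dense and $G_\delta$ in $C(X,\mathbb R^m)$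 for every integer $m\ge 2n+1$; (b) $\mathcal H(2,1,m,2n)$ is dense and $G_\delta$ in $C(X,\mathbb R^m)$ for every integer $m\ge 2n+1$; (c) $\mathcal H(1,d,m,n+d(m-d))$ is dense and $G_\delta$ in $C(X,\mathbb R^m)$ for all integers $d\ge 0$ and $m\ge n+d$; (d) if $n=1$, then $\mathcal H(4,1,3,0)$ is dense and $G_\delta$ in $C(X,\mathbb R^3)$. -/

import Mathlib

open Set Topology

noncomputable section

/-- `dim Y ≤ k` for the (Čech–Lebesgue) covering dimension: every finite open cover of `Y` has a
finite open refinement covering `Y` such that each point of `Y` lies in at most `k + 1` of its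
members. For `k < 0` this says that `Y` is empty. -/
def CoveringDimLE (Y : Type*) [TopologicalSpace Y] (k : ℤ) : Prop :=
  ∀ 𝒰 : Set (Set Y), 𝒰.Finite → (∀ U ∈ 𝒰, IsOpen U) → ⋃₀ 𝒰 = univ →
    ∃ 𝒱 : Set (Set Y), 𝒱.Finite ∧ (∀ V ∈ 𝒱, IsOpen V) ∧ ⋃₀ 𝒱 = univ ∧
      (∀ V ∈ 𝒱, ∃ U ∈ 𝒰, V ⊆ U) ∧
      ∀ y : Y, (({V ∈ 𝒱 | y ∈ V}.ncard : ℕ) : ℤ) ≤ k + 1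

/-- The set `M_{m,d}` of all affine `d`-dimensional subspaces (`d`-planes) of `ℝ^m`. -/
def AffPlane (m d : ℕ) : Type :=
  {P : AffineSubspace ℝ (EuclideanSpace ℝ (Fin m)) //
    (P : Set (EuclideanSpace ℝ (Fin m))).Nonempty ∧ Module.finrank ℝ P.direction = d}

namespace AffPlane

variable {m d : ℕ}

/-- The underlying set of points of a `d`-plane. -/
def points (P : AffPlane m d) : Set (EuclideanSpace ℝ (Fin m)) := (P.1 : Set _)

/-- The point of the plane `P` closest to the origin. -/
def foot (P : AffPlane m d) : EuclideanSpace ℝ (Fin m) :=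
  haveI : Nonempty P.1 := P.2.1.to_subtype
  (EuclideanGeometry.orthogonalProjection P.1 0 : EuclideanSpace ℝ (Fin m))

/-- The coordinates of a `d`-plane `P`: the orthogonal projection operator of `ℝ^m` onto the
direction of `P`, and the point of `P` closest to the origin. -/
def code (P : AffPlane m d) :
    (EuclideanSpace ℝ (Fin m) →L[ℝ] EuclideanSpace ℝ (Fin m)) × EuclideanSpace ℝ (Fin m) :=
  (P.1.direction.starProjection, P.foot)

theorem foot_mem (P : AffPlane m d) : P.foot ∈ P.1 := by
  have : Nonempty P.1 := P.2.1.to_subtype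
  exact EuclideanGeometry.orthogonalProjection_mem (s := P.1) 0

theorem code_injective : Function.Injective (code : AffPlane m d → _) := by
  intro P Q h
  have h1 : P.1.direction.starProjection = Q.1.direction.starProjection := congrArg Prod.fst h
  have h2 : P.foot = Q.foot := congrArg Prod.snd h
  apply Subtype.ext
  refine AffineSubspace.ext_of_direction_eq ?_ ⟨P.foot, P.foot_mem, h2 ▸ Q.foot_mem⟩
  exact Submodule.starProjection_inj.mp h1

/-- The metric on `M_{m,d}`: the distance of two planes is the larger one of the operator norm
distance of the orthogonal projections onto their directions and the distance of their points
closest to the origin. It induces the usual topology of the affine Grassmannian. -/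
instance : MetricSpace (AffPlane m d) :=
  MetricSpace.induced code code_injective inferInstance

end AffPlane

/-- `B_{q,d,m}(g)`: the set of all `d`-planes in `ℝ^m` whose preimage under `g` has at least
`q` points. -/
def planesMeeting {X : Type*} [TopologicalSpace X] (q d m : ℕ)
    (g : C(X, EuclideanSpace ℝ (Fin m))) : Set (AffPlane m d) :=
  {P | (q : ℕ∞) ≤ (g ⁻¹' P.points).encard}

/-- `H(q,d,m,k)`: the set of all maps `g : X → ℝ^m` with `dim B_{q,d,m}(g) ≤ k`, where
`B_{q,d,m}(g)` carries the subspace topology. -/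
def mapsH (X : Type*) [TopologicalSpace X] (q d m : ℕ) (k : ℤ) :
    Set C(X, EuclideanSpace ℝ (Fin m)) :=
  {g | CoveringDimLE (planesMeeting q d m g) k}

end

/-! All four statements are one count. Put `c = m - d`. The `d`-planes form a manifold of dimension
`(d+1)c`, and meeting the image of an `n`-dimensional set should cost `c - n` parameters. So `q`
incidences leave the expected dimension `k = (d+1)c + q(n-c)`, and (a)-(d) are values of this
formula. The general case is `dense_isGδ_mapsH`.

To make the bound a Baire category statement, covering dimension is tested by maps to `ℝ^r`, `r =
max(k+1, 0)`. A σ-compact metrizable space has dimension at most `r - 1` iff on each compact piece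
every map to `ℝ^r` is uniformly close to one without zeros (`CoveringDimLE.genericallyAvoids`,
`coveringDimLE_of_genericallyAvoids`). The planes meeting `q` images are a countable union of
compact sets, those coming from points at mutual distance at least `1/(j+1)`. Testing a countable
dense family of maps `F` writes `mapsH` as a countable intersection of sets `avoidingMaps`
(`mapsH_eq_iInter`). These are open by compactness, and it remains to see that they are dense.

For density, replace `g₀` by a map `g = ∑ φ i • v i` into the simplices spanned by points `v i`,
where the `φ i` form a partition of unity subordinate to a fine cover of order at most `n + 1`, and
replace `F` by a `C^1` map `f`. A plane that is a zero of `f - b` and meets the images of `q`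
separated points meets `q` simplices without common vertices. The pairs `(v, b)` admitting such a
plane are covered by countably many locally Lipschitz images of spaces of too small dimension
(`dimH_incidenceSet_le`), so their complement is dense. Any `(v, b)` in it gives a `g` for which `f
- b` has no zero on the separated planes. -/

theorem LocallyLipschitz.dimH_range_le_finrank {E F : Type*} [NormedAddCommGroup E]
    [NormedSpace ℝ E] [FiniteDimensional ℝ E] [EMetricSpace F] {f : E → F}
    (hf : LocallyLipschitz f) : dimH (range f) ≤ Module.finrank ℝ E := by
  have := FiniteDimensional.proper ℝ E
  rw [← Real.dimH_univ_eq_finrank E]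
  exact dimH_range_le_of_locally_lipschitzOn hf

/-! ### General position of vertices by a Hausdorff dimension count -/

section GeneralPosition

variable {ι Q F G : Type*} {q : ℕ}

/-- The configurations `v` of vertices together with a value `c` such that, for some parameter `ρ`
with `h ρ = c`, the points `p ρ i` are affine combinations of the vertices in pairwise disjoint
sets of at most `n + 1` vertices. -/
def incidenceSet [AddCommGroup F] [Module ℝ F] (ι : Type*) (n : ℕ) (p : Q → Fin q → F)
    (h : Q → G) : Set ((ι → F) × G) :=
  {z | ∃ ρ : Q, h ρ = z.2 ∧ ∃ (σ : Fin q → Finset ι) (s : Fin q → ι → ℝ),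
    (∀ i j, i ≠ j → Disjoint (σ i) (σ j)) ∧ (∀ i, (σ i).card ≤ n + 1) ∧
    (∀ i, ∑ x ∈ σ i, s i x = 1) ∧ ∀ i, ∑ x ∈ σ i, s i x • z.1 x = p ρ i}

open Classical in
/-- The configuration of vertices in which the vertices `w i` are determined by the points `P i`,
the ratios `t i` of barycentric coordinates and the remaining vertices `u`. -/
noncomputable def solveVertices [AddCommGroup F] [Module ℝ F] (w : Fin q → ι) (τ : Fin q → Finset ι)
    (P : Fin q → F) (t : ∀ i, τ i → ℝ) (u : {j // ¬∃ i, w i = j} → F) (j : ι) : F :=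
  if hj : ∃ i, w i = j then
    P hj.choose + ∑ x : τ hj.choose, t hj.choose x •
      ((if hx : ∃ i, w i = x.1 then 0 else u ⟨x.1, hx⟩) - P hj.choose)
  else u ⟨j, hj⟩

theorem solveVertices_eq [AddCommGroup F] [Module ℝ F] {w : Fin q → ι}
    {τ : Fin q → Finset ι} (hτ : ∀ i, ∀ x ∈ τ i, ¬∃ j, w j = x) {P : Fin q → F} {v : ι → F}
    {t : ∀ i, τ i → ℝ}
    (hv : ∀ i, v (w i) = P i + ∑ x : τ i, t i x • (v x - P i)) :
    solveVertices w τ P t (fun j => v j) = v := by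
  funext j
  unfold solveVertices
  split_ifs with hj
  · conv_rhs => rw [← hj.choose_spec, hv]
    congr 1
    refine Finset.sum_congr rfl fun x _ => ?_
    rw [dif_neg (hτ _ x.1 x.2)]
  · rfl

variable [NormedAddCommGroup F] [NormedSpace ℝ F]

open Classical in
theorem contDiff_solveVertices [Fintype ι] (w : Fin q → ι) (τ : Fin q → Finset ι) :
    ContDiff ℝ 1 (fun z : (Fin q → F) × (∀ i, τ i → ℝ) × ({j // ¬∃ i, w i = j} → F) =>
      solveVertices w τ z.1 z.2.1 z.2.2) := by
  refine contDiff_pi.2 fun j => ?_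
  unfold solveVertices
  split_ifs with hj
  · refine ContDiff.add (by fun_prop) (ContDiff.sum fun x _ => ContDiff.smul ?_ ?_)
    · exact contDiff_pi.1 (contDiff_pi.1 (by fun_prop) hj.choose) x
    refine ContDiff.sub ?_ (by fun_prop)
    split_ifs <;> fun_prop
  · fun_prop

/-- Since the coefficients sum to `1`, some `s w` is nonzero, and `∑ s x • (v x - P) = 0` can be
solved for `v w` with ratios `t x = -(s x / s w)`. Thus one vertex is determined by `P`, the other
vertices and at most `n` ratios. The set `τ` is described by its members to keep decidable equality
out of the statement. -/
theorem exists_ratios {σ : Finset ι} {s : ι → ℝ} {v : ι → F} {P : F} (h1 : ∑ x ∈ σ, s x = 1)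
    (hP : ∑ x ∈ σ, s x • v x = P) :
    ∃ w ∈ σ, ∃ t : ι → ℝ, ∀ τ : Finset ι, (∀ x, x ∈ τ ↔ x ∈ σ ∧ x ≠ w) →
      v w = P + ∑ x : τ, t x • (v x - P) := by
  classical
  obtain ⟨w, hwσ, hw⟩ : ∃ w ∈ σ, s w ≠ 0 := by
    by_contra! hcon
    rw [Finset.sum_eq_zero hcon] at h1
    exact zero_ne_one h1
  refine ⟨w, hwσ, fun x => -(s x / s w), fun τ hτ => ?_⟩
  obtain rfl : τ = σ.erase w := by ext x; rw [hτ, Finset.mem_erase, and_comm]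
  rw [Finset.sum_coe_sort (σ.erase w) (fun x => (-(s x / s w)) • (v x - P))]
  have e1 : ∑ x ∈ σ, s x • (v x - P) = 0 := by
    simp only [smul_sub, Finset.sum_sub_distrib, ← Finset.sum_smul, h1, hP, one_smul, sub_self]
  rw [← Finset.add_sum_erase _ _ hwσ] at e1
  have e2 : ∑ x ∈ σ.erase w, (-(s x / s w)) • (v x - P)
      = -((s w)⁻¹ • ∑ x ∈ σ.erase w, s x • (v x - P)) := by
    rw [Finset.smul_sum, ← Finset.sum_neg_distrib]
    refine Finset.sum_congr rfl fun x _ => ?_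
    rw [smul_smul, ← neg_smul]; congr 1; ring
  rw [e2, eq_neg_of_add_eq_zero_right e1, smul_neg, neg_neg, smul_smul, inv_mul_cancel₀ hw,
    one_smul]
  abel

variable [NormedAddCommGroup Q] [NormedSpace ℝ Q] [FiniteDimensional ℝ Q]
  [FiniteDimensional ℝ F] [NormedAddCommGroup G]

/-- Each of the `q` points fixes a vertex, disjointness makes these vertices distinct, and what
remains free is `ρ`, at most `n` ratios per point, and the other `card ι - q` vertices. The vertices
are polynomial in the points, the ratios and the remaining vertices, so the parametrization is
locally Lipschitz and does not raise dimension. -/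
theorem dimH_incidenceSet_le [Fintype ι] {n D : ℕ} {p : Q → Fin q → F} {h : Q → G}
    (hp : LocallyLipschitz p) (hh : LocallyLipschitz h)
    (hD : Module.finrank ℝ Q + q * n + Fintype.card ι * Module.finrank ℝ F
      ≤ D + q * Module.finrank ℝ F) :
    dimH (incidenceSet ι n p h) ≤ D := by
  classical
  -- The finitely many combinatorial types: the vertex solved for in each simplex, and the rest of
  -- that simplex.
  let C := {a : (Fin q → ι) × (Fin q → Finset ι) // Function.Injective a.1 ∧
    ∀ i, (a.2 i).card ≤ n}
  let Ψ : ∀ a : C, Q × (∀ i, a.1.2 i → ℝ) × ({j // ¬∃ i, a.1.1 i = j} → F) → (ι → F) × G :=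
    fun a z => (solveVertices a.1.1 a.1.2 (p z.1) z.2.1 z.2.2, h z.1)
  have hsub : incidenceSet ι n p h ⊆ ⋃ a : C, range (Ψ a) := by
    rintro ⟨v, c⟩ ⟨ρ, hc, σ, s, hdis, hcard, h1, hP⟩
    choose w hw t ht using fun i => exists_ratios (h1 i) (hP i)
    have hinj : Function.Injective w := by
      intro i j hij
      by_contra hne
      exact Finset.disjoint_left.1 (hdis i j hne) (hw i) (hij ▸ hw j)
    refine mem_iUnion.2 ⟨⟨(w, fun i => (σ i).erase (w i)), hinj, fun i => ?_⟩,
      ⟨(ρ, fun i x => t i x, fun j => v j), ?_⟩⟩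
    · rw [Finset.card_erase_of_mem (hw i)]
      have := hcard i
      omega
    · refine Prod.ext ?_ hc
      refine solveVertices_eq ?_ ?_
      · rintro i x hx ⟨j, rfl⟩
        rw [Finset.mem_erase] at hx
        by_cases hij : i = j
        · exact hx.1 (by rw [hij])
        · exact Finset.disjoint_left.1 (hdis i j hij) hx.2 (hw j)
      · intro i
        exact ht i _ fun x => by rw [Finset.mem_erase, and_comm]
  refine (dimH_mono hsub).trans ?_
  rw [dimH_iUnion]
  refine iSup_le fun a => ?_
  have hlip : LocallyLipschitz (Ψ a) := by
    refine LocallyLipschitz.prodMk ?_ (hh.comp LipschitzWith.prod_fst.locallyLipschitz)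
    exact ((contDiff_solveVertices a.1.1 a.1.2).locallyLipschitz).comp
      ((hp.comp LipschitzWith.prod_fst.locallyLipschitz).prodMk
        LipschitzWith.prod_snd.locallyLipschitz)
  refine hlip.dimH_range_le_finrank.trans ?_
  norm_cast
  rw [Module.finrank_prod, Module.finrank_prod, Module.finrank_pi_fintype,
    Module.finrank_pi_fintype]
  simp only [Module.finrank_fintype_fun_eq_card, Fintype.card_coe, Finset.sum_const,
    Finset.card_univ, smul_eq_mul]
  have e1 : ∑ i, (a.1.2 i).card ≤ q * n := by
    simpa using Finset.sum_le_sum fun i (_ : i ∈ Finset.univ) => a.2.2 i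
  have e2 : Fintype.card {j // ¬∃ i, a.1.1 i = j} + q = Fintype.card ι := by
    have e3 : Fintype.card {j // ∃ i, a.1.1 i = j} = q := by
      have := Set.card_range_of_injective a.2.1
      rw [Fintype.card_fin] at this
      refine Eq.trans ?_ this
      exact Fintype.card_congr (Equiv.refl _)
    have := Fintype.card_subtype_compl (fun j => ∃ i, a.1.1 i = j)
    have h4 := Fintype.card_subtype_le (fun j => ∃ i, a.1.1 i = j)
    omega
  rw [← e2, add_mul] at hD
  omega

end GeneralPosition

/-! ### Covering dimension through zero-free approximations -/

/-- Every continuous map `f : Z → ℝ^r` has, uniformly on `K`, arbitrarily close continuous maps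
without zeros on `K`. For compact metrizable `K` this says `dim K ≤ r - 1`. -/
def GenericallyAvoids {Z : Type*} [TopologicalSpace Z] (K : Set Z) (r : ℕ) : Prop :=
  ∀ (f : C(Z, Fin r → ℝ)) (δ : ℝ), 0 < δ →
    ∃ f' : C(Z, Fin r → ℝ), ∀ x ∈ K, dist (f' x) (f x) < δ ∧ f' x ≠ 0

theorem CoveringDimLE.exists_partition {Y : Type*} [TopologicalSpace Y] [NormalSpace Y] {r : ℕ}
    (hY : CoveringDimLE Y ((r : ℤ) - 1)) {𝒰 : Set (Set Y)} (hf : 𝒰.Finite)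
    (ho : ∀ U ∈ 𝒰, IsOpen U) (hc : ⋃₀ 𝒰 = univ) :
    ∃ (𝒱 : Finset (Set Y)) (φ : 𝒱 → C(Y, ℝ)), (∀ i y, 0 ≤ φ i y) ∧ (∀ y, ∑ i, φ i y = 1) ∧
      (∀ i, ∃ U ∈ 𝒰, ∀ y, φ i y ≠ 0 → y ∈ U) ∧
      ∀ y (s : Finset 𝒱), (∀ i ∈ s, φ i y ≠ 0) → s.card ≤ r := by
  classical
  obtain ⟨𝒱, h𝒱, hopen, hcov, href, hord⟩ := hY 𝒰 hf ho hc
  lift 𝒱 to Finset (Set Y) using h𝒱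
  obtain ⟨φ, hφ⟩ := PartitionOfUnity.exists_isSubordinate_of_locallyFinite (s := univ)
    isClosed_univ (fun i : 𝒱 => i.1) (fun i => hopen i.1 (by simp)) (locallyFinite_of_finite _)
    (by rw [← hcov]; intro y hy; simpa using hy)
  have hmem : ∀ i y, φ i y ≠ 0 → y ∈ i.1 := fun i y hy => hφ i (subset_tsupport _ hy)
  refine ⟨𝒱, φ, fun i y => φ.nonneg i y, fun y => ?_, fun i => ?_, fun y s hs => ?_⟩
  · rw [← φ.sum_eq_one (mem_univ y), finsum_eq_sum_of_fintype]
  · obtain ⟨U, hU, hVU⟩ := href i.1 (by simp)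
    exact ⟨U, hU, fun y hy => hVU (hmem i y hy)⟩
  · have h1 := hord y
    have h2 : (s.map (Function.Embedding.subtype _) : Finset (Set Y)).card
        ≤ {V ∈ (𝒱 : Set (Set Y)) | y ∈ V}.ncard := by
      rw [← Set.ncard_coe_finset]
      refine Set.ncard_le_ncard ?_ (𝒱.finite_toSet.subset (Set.sep_subset _ _))
      intro V hV
      simp only [Finset.coe_map, mem_image, Finset.mem_coe] at hV
      obtain ⟨i, hi, rfl⟩ := hV
      exact ⟨i.2, hmem i y (hs i hi)⟩
    rw [Finset.card_map] at h2
    omega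

/-- Any configuration of points of `ℝ^r` has arbitrarily close ones no `r` of whose points have `0`
as an affine combination. -/
theorem exists_generic_near {ι : Type*} [Fintype ι] {r : ℕ} (v₀ : ι → Fin r → ℝ) {δ : ℝ}
    (hδ : 0 < δ) : ∃ v : ι → Fin r → ℝ, dist v v₀ < δ ∧
      ∀ (σ : Finset ι) (s : ι → ℝ), σ.card ≤ r → ∑ x ∈ σ, s x = 1 → ∑ x ∈ σ, s x • v x ≠ 0 := by
  rcases r with _ | n
  · refine ⟨v₀, by simpa using hδ, fun σ s hσ h1 => ?_⟩
    rw [Nat.le_zero, Finset.card_eq_zero] at hσ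
    simp [hσ] at h1
  let p : (Fin 0 → ℝ) → Fin 1 → Fin (n + 1) → ℝ := fun _ _ => 0
  let h : (Fin 0 → ℝ) → Fin 0 → ℝ := fun _ => 0
  cases isEmpty_or_nonempty ι with
  | inl hι =>
    refine ⟨v₀, by simpa using hδ, fun σ s hσ h1 => ?_⟩
    simp [Subsingleton.elim σ ∅] at h1
  | inr hι =>
  have hpos : 0 < Fintype.card ι * (n + 1) := Nat.mul_pos Fintype.card_pos (Nat.succ_pos n)
  -- The count with `q = 1`, the single point `0` and a zero-dimensional parameter space:
  -- codimension one.
  have hd : dimH (incidenceSet ι n p h) ≤ (Fintype.card ι * (n + 1) - 1 : ℕ) := by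
    refine dimH_incidenceSet_le (LocallyLipschitz.const _) (LocallyLipschitz.const _) ?_
    simp
    omega
  have hdense : Dense (incidenceSet ι n p h)ᶜ := by
    refine dense_compl_of_dimH_lt_finrank (hd.trans_lt ?_)
    norm_cast
    simp [Module.finrank_prod, Module.finrank_pi_fintype, Fintype.card_pos]
  obtain ⟨⟨v, c⟩, hv, hdist⟩ := hdense.exists_dist_lt (v₀, 0) hδ
  refine ⟨v, ?_, fun σ s hσ h1 h0 => hv ⟨0, Subsingleton.elim _ _, fun _ => σ, fun _ => s, ?_,
    fun _ => hσ, fun _ => h1, fun _ => h0⟩⟩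
  · rw [dist_comm]
    exact (le_max_left _ _).trans_lt hdist
  · intro i j hij
    exact absurd (Subsingleton.elim i j) hij

/-- On `K`, `f` is close to a map `∑ φ i • v i` with at most `r` nonzero terms at each point. For
generic `v i` in `ℝ^r` no such affine combination vanishes. The result is extended from `K` to `Z`
by Tietze. -/
theorem CoveringDimLE.genericallyAvoids {Z : Type*} [TopologicalSpace Z]
    [TopologicalSpace.MetrizableSpace Z] {Y K : Set Z} {r : ℕ}
    (hY : CoveringDimLE Y ((r : ℤ) - 1)) (hK : IsCompact K) (hKY : K ⊆ Y) :
    GenericallyAvoids K r := by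
  classical
  let _ := TopologicalSpace.metrizableSpaceMetric Z
  intro f δ hδ
  obtain ⟨t, htK, htc⟩ := hK.elim_nhds_subcover (fun x => f ⁻¹' Metric.ball (f x) (δ / 2))
    (fun x _ => f.continuous.continuousAt.preimage_mem_nhds (Metric.ball_mem_nhds _ (by positivity)))
  -- The extra member, the complement of `K`, completes the cover of `Y`; nothing has to be
  -- controlled there.
  let W : Option t → Set Y := fun o => o.elim (Subtype.val ⁻¹' Kᶜ)
    fun x => Subtype.val ⁻¹' (f ⁻¹' Metric.ball (f x) (δ / 2))
  have hWo : ∀ U ∈ range W, IsOpen U := by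
    rintro _ ⟨_ | x, rfl⟩
    · exact hK.isClosed.isOpen_compl.preimage continuous_subtype_val
    · exact (Metric.isOpen_ball.preimage f.continuous).preimage continuous_subtype_val
  have hWc : ⋃₀ range W = univ := by
    refine eq_univ_of_forall fun y => ?_
    by_cases hy : y.1 ∈ K
    · obtain ⟨x, hx, hyx⟩ := mem_iUnion₂.1 (htc hy)
      exact ⟨_, ⟨some ⟨x, hx⟩, rfl⟩, hyx⟩
    · exact ⟨_, ⟨none, rfl⟩, hy⟩
  obtain ⟨𝒱, φ, hφ0, hφ1, hφU, hφr⟩ := hY.exists_partition (finite_range W) hWo hWc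
  have hbase : ∀ i, ∃ a : Fin r → ℝ, ∀ y : Y, y.1 ∈ K → φ i y ≠ 0 → dist (f y) a < δ / 2 := by
    intro i
    obtain ⟨_, ⟨_ | x, rfl⟩, hU⟩ := hφU i
    · exact ⟨0, fun y hy hne => absurd hy (hU y hne)⟩
    · exact ⟨f x, fun y hy hne => hU y hne⟩
  choose a ha using hbase
  obtain ⟨v, hv, hgen⟩ := exists_generic_near a (half_pos hδ)
  let g : C(K, Fin r → ℝ) := ⟨fun y => ∑ i, φ i ⟨y.1, hKY y.2⟩ • v i, by fun_prop⟩
  obtain ⟨f', hf'⟩ := ContinuousMap.exists_restrict_eq hK.isClosed g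
  refine ⟨f', fun x hx => ?_⟩
  have hval : f' x = ∑ i, φ i ⟨x, hKY hx⟩ • v i := congrArg (fun e => e ⟨x, hx⟩) hf'
  have hsum : ∑ i with φ i ⟨x, hKY hx⟩ ≠ 0, φ i ⟨x, hKY hx⟩ = 1 := by
    rw [Finset.sum_filter_ne_zero, hφ1]
  rw [hval, ← Finset.sum_filter_of_ne (p := fun i => φ i ⟨x, hKY hx⟩ ≠ 0)
    (fun i _ h => left_ne_zero_of_smul h)]
  refine ⟨?_, hgen _ (fun i => φ i ⟨x, hKY hx⟩)
    (hφr _ _ fun i hi => (Finset.mem_filter.1 hi).2) hsum⟩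
  refine (convex_ball (f x) δ).sum_mem (fun i _ => hφ0 i _) hsum fun i hi => ?_
  have h3 : dist (f x) (a i) < δ / 2 := ha i ⟨x, hKY hx⟩ hx (Finset.mem_filter.1 hi).2
  have h4 := (dist_le_pi_dist v a i).trans_lt hv
  have := dist_triangle_right (v i) (f x) (a i)
  rw [Metric.mem_ball]
  linarith

/-- A system of functions `h i` of which fewer than `r` take the value `τ` at any point, and with
one of them greater than `τ` at every point, gives a cover of order at most `r` by sets on each of
which one of the `h i` is greater than `τ`. -/
theorem exists_cover_of_threshold {Y ι : Type*} [TopologicalSpace Y] [Fintype ι] {r : ℕ}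
    (h : ι → C(Y, ℝ)) (τ : ℝ) (hlt : ∀ y, ∃ i, τ < h i y)
    (hr : ∀ y (s : Finset ι), (∀ i ∈ s, h i y = τ) → s.card < r) :
    ∃ 𝒱 : Set (Set Y), 𝒱.Finite ∧ (∀ V ∈ 𝒱, IsOpen V) ∧ ⋃₀ 𝒱 = univ ∧
      (∀ V ∈ 𝒱, ∃ i, ∀ y ∈ V, τ < h i y) ∧ ∀ y, {V ∈ 𝒱 | y ∈ V}.ncard ≤ r := by
  classical
  -- For a pair `(S, T)`: the values with index in `S` are nearer to `τ` than all others, those in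
  -- `T` lie above `τ`, the remaining ones below. At a given point, the size of `S` determines `S`
  -- and then `T`, so sizes `0, …, r - 1` give at most `r` members through it.
  let O : Finset ι × Finset ι → Set Y := fun P =>
    {y | (∀ i ∈ P.1, ∀ j ∉ P.1, |h i y - τ| < |h j y - τ|) ∧ (∀ j ∈ P.2, τ < h j y) ∧
      ∀ j, j ∉ P.1 → j ∉ P.2 → h j y < τ}
  let A : Set (Finset ι × Finset ι) := {P | P.1.card < r ∧ Disjoint P.1 P.2 ∧ P.2.Nonempty}
  have hopen : ∀ P, IsOpen (O P) := by
    intro P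
    simp only [O, Set.ofPred_and, Set.ofPred_forall]
    refine IsOpen.inter ?_ (IsOpen.inter ?_ ?_)
    · exact isOpen_iInter_of_finite fun i => isOpen_iInter_of_finite fun _ =>
        isOpen_iInter_of_finite fun j => isOpen_iInter_of_finite fun _ =>
          isOpen_lt (by fun_prop) (by fun_prop)
    · exact isOpen_iInter_of_finite fun i => isOpen_iInter_of_finite fun _ =>
        isOpen_lt (by fun_prop) (by fun_prop)
    · exact isOpen_iInter_of_finite fun j => isOpen_iInter_of_finite fun _ =>
        isOpen_iInter_of_finite fun _ => isOpen_lt (by fun_prop) (by fun_prop)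
  have huniq : ∀ P ∈ A, ∀ P' ∈ A, ∀ y, y ∈ O P → y ∈ O P' → P.1.card = P'.1.card → P = P' := by
    rintro ⟨S, T⟩ ⟨-, hd, -⟩ ⟨S', T'⟩ ⟨-, hd', -⟩ y ⟨h1, h2, h3⟩ ⟨h1', h2', h3'⟩ hcard
    simp only at *
    have hS : S = S' := by
      by_contra hne
      obtain ⟨i, hi, hi'⟩ := Finset.not_subset.1 fun hsub =>
        hne (Finset.eq_of_subset_of_card_le hsub hcard.ge)
      obtain ⟨j, hj, hj'⟩ := Finset.not_subset.1 fun hsub =>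
        hne (Finset.eq_of_subset_of_card_le hsub hcard.le).symm
      exact lt_asymm (h1 i hi j hj') (h1' j hj i hi')
    subst hS
    refine Prod.ext rfl (Finset.ext fun j => ⟨fun hj => ?_, fun hj => ?_⟩)
    · by_contra hj'
      exact lt_asymm (h2 j hj) (h3' j (Finset.disjoint_right.1 hd hj) hj')
    · by_contra hj'
      exact lt_asymm (h2' j hj) (h3 j (Finset.disjoint_right.1 hd' hj) hj')
  refine ⟨O '' A, (toFinite A).image O, ?_, ?_, ?_, fun y => ?_⟩
  · rintro _ ⟨P, -, rfl⟩
    exact hopen P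
  · refine eq_univ_of_forall fun y => ⟨_, ⟨(({i | h i y = τ} : Finset ι), ({i | τ < h i y} : Finset ι)),
      ⟨?_, ?_, ?_⟩, rfl⟩, ?_, ?_, ?_⟩
    · exact hr y _ (by simp)
    · rw [Finset.disjoint_left]
      intro i hi
      simp only [Finset.mem_filter_univ] at hi ⊢
      exact hi.not_gt
    · obtain ⟨i, hi⟩ := hlt y
      exact ⟨i, by simpa using hi⟩
    · intro i hi j hj
      simp only [Finset.mem_filter_univ] at hi hj
      rw [hi, sub_self, abs_zero]
      exact abs_pos.2 (sub_ne_zero.2 hj)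
    · simp
    · intro j hj hj'
      simp only [Finset.mem_filter_univ] at hj hj'
      exact lt_of_le_of_ne (not_lt.1 hj') hj
  · rintro _ ⟨P, ⟨-, -, j, hj⟩, rfl⟩
    exact ⟨j, fun y hy => hy.2.1 j hj⟩
  · have hsub : {V ∈ O '' A | y ∈ V} = O '' {P ∈ A | y ∈ O P} := by
      ext V
      constructor
      · rintro ⟨⟨P, hP, rfl⟩, hy⟩
        exact ⟨P, ⟨hP, hy⟩, rfl⟩
      · rintro ⟨P, ⟨hP, hy⟩, rfl⟩
        exact ⟨⟨P, hP, rfl⟩, hy⟩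
    rw [hsub]
    refine (ncard_image_le (toFinite _)).trans ?_
    refine (ncard_le_ncard_of_injOn (t := (Finset.range r : Set ℕ)) (fun P => P.1.card)
      (fun P hP => by simpa using hP.1.1) ?_ (toFinite _)).trans (by simp)
    intro P hP P' hP' hcard
    exact huniq P hP.1 P' hP'.1 y hP.2 hP'.2 hcard

open BoundedContinuousFunction in
theorem isOpen_setOf_forall_exists_ne {Y ι : Type*} [TopologicalSpace Y] [Fintype ι] {r : ℕ}
    {K : Set Y} (hK : IsCompact K) (e : Fin r → ι) (τ : ℝ) :
    IsOpen {h : Y →ᵇ (ι → ℝ) | ∀ y ∈ K, ∃ i, h y (e i) ≠ τ} := by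
  have h1 : IsOpen {f : C(Y, Fin r → ℝ) | MapsTo f K {fun _ => τ}ᶜ} :=
    ContinuousMap.isOpen_setOfPred_mapsTo hK isOpen_compl_singleton
  have h2 : Continuous fun h : Y →ᵇ (ι → ℝ) =>
      (⟨fun y i => h y (e i), by fun_prop⟩ : C(Y, Fin r → ℝ)) := by
    refine ContinuousMap.continuous_of_continuous_uncurry _ ?_
    refine continuous_pi fun i => ?_
    exact (continuous_apply (e i)).comp continuous_eval
  convert h1.preimage h2 using 1
  ext h
  simp [MapsTo, funext_iff]

open BoundedContinuousFunction in
theorem GenericallyAvoids.dense_setOf_forall_exists_ne {Y ι : Type*} [TopologicalSpace Y]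
    [Fintype ι] {r : ℕ} {K : Set Y}
    (hA : GenericallyAvoids K r) {e : Fin r → ι} (he : Function.Injective e) (τ : ℝ) :
    Dense {h : Y →ᵇ (ι → ℝ) | ∀ y ∈ K, ∃ i, h y (e i) ≠ τ} := by
  classical
  rw [Metric.dense_iff]
  intro h δ hδ
  obtain ⟨f', hf'⟩ := hA ⟨fun y i => h y (e i) - τ, by fun_prop⟩ (δ / 2) (half_pos hδ)
  -- The perturbation is clipped at `δ / 2` to be bounded on all of `Y`, and is zero in the
  -- coordinates outside the range of `e`. On `K` the clipping has no effect.
  let w : Y → ι → ℝ := fun y =>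
    Function.extend e (fun i => max (-(δ / 2)) (min (δ / 2) (f' y i - (h y (e i) - τ)))) 0
  have hw1 : ∀ y i, w y (e i) = max (-(δ / 2)) (min (δ / 2) (f' y i - (h y (e i) - τ))) :=
    fun y i => he.extend_apply _ _ _
  have hw0 : ∀ y j, (¬∃ i, e i = j) → w y j = 0 := fun y j hj => Function.extend_apply' _ _ _ hj
  have hwc : Continuous w := by
    refine continuous_pi fun j => ?_
    by_cases hj : ∃ i, e i = j
    · obtain ⟨i, rfl⟩ := hj
      simp only [hw1]
      fun_prop
    · simp only [hw0 _ j hj]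
      fun_prop
  have hwb : ∀ y, ‖w y‖ ≤ δ / 2 := fun y => by
    refine (pi_norm_le_iff_of_nonneg (half_pos hδ).le).2 fun j => ?_
    by_cases hj : ∃ i, e i = j
    · obtain ⟨i, rfl⟩ := hj
      rw [hw1, Real.norm_eq_abs, abs_le]
      exact ⟨le_max_left _ _, max_le (by linarith) (min_le_left _ _)⟩
    · rw [hw0 _ j hj, norm_zero]
      positivity
  let W : Y →ᵇ (ι → ℝ) := BoundedContinuousFunction.ofNormedAddCommGroup w hwc (δ / 2) hwb
  refine ⟨h + W, ?_, fun y hy => ?_⟩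
  · rw [Metric.mem_ball, dist_eq_norm, add_sub_cancel_left]
    exact (BoundedContinuousFunction.norm_ofNormedAddCommGroup_le hwc (half_pos hδ).le hwb).trans_lt
      (half_lt_self hδ)
  · obtain ⟨hd, hne⟩ := hf' y hy
    obtain ⟨i, hi⟩ := Function.ne_iff.1 hne
    refine ⟨i, ?_⟩
    have h1 := abs_lt.1 ((dist_le_pi_dist _ _ i).trans_lt hd)
    simp only [ContinuousMap.coe_mk] at h1
    have h2 : w y (e i) = f' y i - (h y (e i) - τ) := by
      rw [hw1, min_eq_right h1.2.le, max_eq_right h1.1.le]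
    have h3 : (h + W) y (e i) = f' y i + τ := by
      change h y (e i) + w y (e i) = _
      rw [h2]; ring
    rw [h3]
    simpa using hi

open BoundedContinuousFunction in
-- By Baire, a partition of unity can be perturbed to functions of which no `r` take the value `τ`
-- at a common point; the avoidance hypothesis is used for each choice of `r` distinct indices and
-- each `K j`. Then `exists_cover_of_threshold` gives the refinement.
theorem coveringDimLE_of_genericallyAvoids {Y : Type*} [TopologicalSpace Y]
    [TopologicalSpace.MetrizableSpace Y] {r : ℕ} (K : ℕ → Set Y) (hK : ∀ j, IsCompact (K j))
    (hcov : ⋃ j, K j = univ) (hA : ∀ j, GenericallyAvoids (K j) r) :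
    CoveringDimLE Y ((r : ℤ) - 1) := by
  classical
  let _ := TopologicalSpace.metrizableSpaceMetric Y
  intro 𝒰 hfin ho hc
  lift 𝒰 to Finset (Set Y) using hfin
  obtain ⟨φ, hφ⟩ := PartitionOfUnity.exists_isSubordinate_of_locallyFinite (s := univ)
    isClosed_univ (fun i : 𝒰 => i.1) (fun i => ho i.1 (by simp)) (locallyFinite_of_finite _)
    (by rw [← hc]; intro y hy; simpa using hy)
  have hmem : ∀ i y, φ i y ≠ 0 → y ∈ i.1 := fun i y hy => hφ i (subset_tsupport _ hy)
  have hsum : ∀ y, ∑ i, φ i y = 1 := fun y => by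
    rw [← φ.sum_eq_one (mem_univ y), finsum_eq_sum_of_fintype]
  let f : Y →ᵇ (𝒰 → ℝ) := BoundedContinuousFunction.ofNormedAddCommGroup
    (fun y i => φ i y) (by fun_prop) 1 (fun y => (pi_norm_le_iff_of_nonneg zero_le_one).2 fun i => by
      rw [Real.norm_of_nonneg (φ.nonneg i y)]
      exact φ.le_one i y)
  let N : ℝ := Fintype.card 𝒰
  have hN : 0 ≤ N := Nat.cast_nonneg _
  -- Small enough that some `φ i y` exceeds `2 * τ`, as the `N` values sum to `1`. An error below
  -- `τ` then leaves some `h y i > τ`, while `h y i > τ` still forces `φ i y ≠ 0`.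
  let τ : ℝ := 1 / (2 * (N + 1))
  have hτ : 0 < τ := by positivity
  have hdense : Dense (⋂ P : ℕ × {e : Fin r → 𝒰 // Function.Injective e},
      {h : Y →ᵇ (𝒰 → ℝ) | ∀ y ∈ K P.1, ∃ i, h y (P.2.1 i) ≠ τ}) :=
    dense_iInter_of_isOpen (fun P => isOpen_setOf_forall_exists_ne (hK P.1) _ _)
      fun P => (hA P.1).dense_setOf_forall_exists_ne P.2.2 _
  obtain ⟨h, hh, hdist⟩ := hdense.exists_dist_lt f hτ
  have hclose : ∀ y i, |φ i y - h y i| < τ := fun y i =>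
    ((dist_le_pi_dist (f y) (h y) i).trans (dist_coe_le_dist y)).trans_lt hdist
  have hlt : ∀ y, ∃ i, τ < h y i := by
    intro y
    by_contra! hcon
    have h6 : ∑ i : 𝒰, φ i y ≤ ∑ i : 𝒰, 2 * τ := Finset.sum_le_sum fun i _ => by
      have := (abs_lt.1 (hclose y i)).2
      have := hcon i
      linarith
    rw [hsum, Finset.sum_const, Finset.card_univ, nsmul_eq_mul] at h6
    have h7 : (Fintype.card 𝒰 : ℝ) * (2 * τ) = N / (N + 1) := by
      simp only [τ, N]; field_simp
    rw [h7, le_div_iff₀ (by positivity)] at h6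
    linarith
  have hlr : ∀ y (s : Finset 𝒰), (∀ i ∈ s, h y i = τ) → s.card < r := by
    intro y s hs
    by_contra! hcon
    obtain ⟨j, hj⟩ := mem_iUnion.1 (hcov ▸ mem_univ y : y ∈ ⋃ j, K j)
    obtain ⟨s', hs', hcard⟩ := Finset.exists_subset_card_eq hcon
    let e : Fin r → 𝒰 := fun i => (s'.equivFinOfCardEq hcard).symm i
    have he : Function.Injective e :=
      Subtype.val_injective.comp (s'.equivFinOfCardEq hcard).symm.injective
    obtain ⟨i, hi⟩ := mem_iInter.1 hh (j, ⟨e, he⟩) y hj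
    exact hi (hs _ (hs' ((s'.equivFinOfCardEq hcard).symm i).2))
  obtain ⟨𝒱, h1, h2, h3, h4, h5⟩ := exists_cover_of_threshold (r := r)
    (fun i : 𝒰 => (⟨fun y => h y i, by fun_prop⟩ : C(Y, ℝ))) τ hlt hlr
  refine ⟨𝒱, h1, h2, h3, fun V hV => ?_, fun y => by have := h5 y; omega⟩
  obtain ⟨i, hi⟩ := h4 V hV
  refine ⟨i.1, by simp, fun y hy => hmem i y fun h0 => ?_⟩
  have h6 := hclose y i
  rw [h0, zero_sub, abs_neg] at h6
  exact lt_asymm (hi y hy) ((le_abs_self _).trans_lt h6)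

theorem GenericallyAvoids.preimage_val {Z : Type*} [TopologicalSpace Z]
    [TopologicalSpace.MetrizableSpace Z] {Y K : Set Z} {r : ℕ} (hA : GenericallyAvoids K r)
    (hK : IsCompact K) (hKY : K ⊆ Y) : GenericallyAvoids (Subtype.val ⁻¹' K : Set Y) r := by
  let _ := TopologicalSpace.metrizableSpaceMetric Z
  intro f δ hδ
  obtain ⟨F, hF⟩ := ContinuousMap.exists_restrict_eq hK.isClosed
    (f.comp ⟨fun x : K => (⟨x.1, hKY x.2⟩ : Y), by fun_prop⟩)
  obtain ⟨F', hF'⟩ := hA F δ hδ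
  refine ⟨F'.comp ⟨Subtype.val, continuous_subtype_val⟩, fun y hy => ?_⟩
  have h1 : F y.1 = f y := congrArg (fun e => e ⟨y.1, hy⟩) hF
  rw [← h1]
  exact hF' y.1 hy

/-! ### Graph charts of the Grassmannian -/

namespace Submodule

variable {V : Type*} [NormedAddCommGroup V] [InnerProductSpace ℝ V]

/-- The graph over a subspace `W` of a linear map from `W` to its orthogonal complement. -/
noncomputable def graphOver (W : Submodule ℝ V) (T : W →L[ℝ] Wᗮ) : Submodule ℝ V :=
  LinearMap.range (W.subtype + Wᗮ.subtype ∘ₗ (T : W →ₗ[ℝ] Wᗮ))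

theorem mem_graphOver {W : Submodule ℝ V} {T : W →L[ℝ] Wᗮ} {x : V} :
    x ∈ W.graphOver T ↔ ∃ w : W, (w : V) + (T w : V) = x := by
  simp [graphOver]

theorem norm_le_norm_add_of_mem_orthogonal {W : Submodule ℝ V} {w u : V} (hw : w ∈ W)
    (hu : u ∈ Wᗮ) : ‖w‖ ≤ ‖w + u‖ := by
  have h := norm_add_sq_eq_norm_sq_add_norm_sq_of_inner_eq_zero w u
    (Submodule.inner_right_of_mem_orthogonal hw hu)
  nlinarith [norm_nonneg w, norm_nonneg u, norm_nonneg (w + u)]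

theorem norm_sub_starProjection_le (W : Submodule ℝ V) [W.HasOrthogonalProjection] (x : V) {y : V}
    (hy : y ∈ W) : ‖x - W.starProjection x‖ ≤ ‖x - y‖ := by
  rw [W.starProjection_minimal x]
  exact ciInf_le ⟨0, by rintro _ ⟨z, rfl⟩; positivity⟩ (⟨y, hy⟩ : W)

variable [FiniteDimensional ℝ V]

/-- A point `w + T w` of one graph lies within `‖T - S‖ * ‖w‖` of the point `w + S w` of the other,
and `‖w‖ ≤ ‖w + T w‖` by orthogonality. -/
theorem norm_starProjection_orthogonal_comp_le (W : Submodule ℝ V) (T S : W →L[ℝ] Wᗮ) :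
    ‖(W.graphOver S)ᗮ.starProjection ∘L (W.graphOver T).starProjection‖ ≤ ‖T - S‖ := by
  refine ContinuousLinearMap.opNorm_le_bound _ (T - S).opNorm_nonneg fun x => ?_
  obtain ⟨w, hw⟩ := mem_graphOver.1 ((W.graphOver T).starProjection_apply_mem x)
  rw [ContinuousLinearMap.comp_apply, starProjection_orthogonal_val, ← hw]
  refine (norm_sub_starProjection_le _ _ (mem_graphOver.2 ⟨w, rfl⟩)).trans ?_
  have h1 : (w : V) + (T w : V) - (w + (S w : V)) = ((T - S) w : Wᗮ) := by simp
  rw [h1]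
  change ‖(T - S) w‖ ≤ _
  refine ((T - S).le_opNorm w).trans ?_
  gcongr
  calc ‖w‖ ≤ ‖(w : V) + (T w : V)‖ := norm_le_norm_add_of_mem_orthogonal w.2 (T w).2
    _ ≤ ‖x‖ := by rw [hw]; exact norm_starProjection_apply_le _ _

theorem lipschitzWith_starProjection_graphOver (W : Submodule ℝ V) :
    LipschitzWith 2 fun T : W →L[ℝ] Wᗮ => (W.graphOver T).starProjection := by
  refine LipschitzWith.of_dist_le_mul fun T S => ?_
  rw [dist_eq_norm, dist_eq_norm]
  set P := (W.graphOver T).starProjection with hP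
  set R := (W.graphOver S).starProjection with hR
  -- `P - R = P(1 - R) - (1 - P)R`. The second product is bounded by the previous lemma, the first
  -- by passing to its adjoint `(1 - R)P`.
  have h1 : P - R = P ∘L (W.graphOver S)ᗮ.starProjection
      - (W.graphOver T)ᗮ.starProjection ∘L R := by
    ext x
    simp [starProjection_orthogonal_val, hP, hR]
  have h2 : ‖P ∘L (W.graphOver S)ᗮ.starProjection‖ ≤ ‖T - S‖ := by
    have h3 : P ∘L (W.graphOver S)ᗮ.starProjection
        = ContinuousLinearMap.adjoint ((W.graphOver S)ᗮ.starProjection ∘L P) := by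
      rw [ContinuousLinearMap.adjoint_comp, hP,
        (isSelfAdjoint_starProjection (W.graphOver T)).adjoint_eq,
        (isSelfAdjoint_starProjection (W.graphOver S)ᗮ).adjoint_eq]
    rw [h3, LinearIsometryEquiv.norm_map]
    exact norm_starProjection_orthogonal_comp_le W T S
  have h4 : ‖(W.graphOver T)ᗮ.starProjection ∘L R‖ ≤ ‖T - S‖ := by
    exact (norm_starProjection_orthogonal_comp_le W S T).trans_eq (norm_sub_rev S T)
  rw [h1]
  refine (norm_sub_le _ _).trans ?_
  push_cast
  linarith

/-- The projection onto the graph of `T`, together with the point closest to the origin in the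
translate through `b` of this graph. -/
noncomputable def graphCode (W : Submodule ℝ V) (T : W →L[ℝ] Wᗮ) (b : Wᗮ) : (V →L[ℝ] V) × V :=
  ((W.graphOver T).starProjection, b - (W.graphOver T).starProjection b)

theorem _root_.ContDiff.locallyLipschitz_comp_prodMk {A A' B C Z : Type*} [NormedAddCommGroup A]
    [NormedSpace ℝ A] [NormedAddCommGroup A'] [NormedSpace ℝ A'] [NormedAddCommGroup B]
    [NormedSpace ℝ B] [NormedAddCommGroup C] [NormedSpace ℝ C] [NormedAddCommGroup Z]
    [NormedSpace ℝ Z] {g : A' × B → C} (hg : ContDiff ℝ 1 g) {f : A → A'}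
    (hf : LocallyLipschitz f) (π₁ : Z →L[ℝ] A) (π₂ : Z →L[ℝ] B) :
    LocallyLipschitz fun z => g (f (π₁ z), π₂ z) :=
  hg.locallyLipschitz.comp ((hf.comp π₁.lipschitz.locallyLipschitz).prodMk
    π₂.lipschitz.locallyLipschitz)

theorem contDiff_sub_apply {U B : Type*} [NormedAddCommGroup U]
    [NormedSpace ℝ U] [NormedAddCommGroup B] [NormedSpace ℝ B] (L : B →L[ℝ] U) :
    ContDiff ℝ 1 fun z : (U →L[ℝ] U) × B => (z.1, L z.2 - z.1 (L z.2)) := by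
  have h : ContDiff ℝ 1 fun z : (U →L[ℝ] U) × B => L z.2 := L.contDiff.comp contDiff_snd
  exact contDiff_fst.prodMk (h.sub (contDiff_fst.clm_apply h))

theorem _root_.ContDiff.locallyLipschitz_comp_graphCode {C Z : Type*} [NormedAddCommGroup C]
    [NormedSpace ℝ C] [NormedAddCommGroup Z] [NormedSpace ℝ Z] {f : (V →L[ℝ] V) × V → C}
    (hf : ContDiff ℝ 1 f) (W : Submodule ℝ V) (π₁ : Z →L[ℝ] W →L[ℝ] Wᗮ) (π₂ : Z →L[ℝ] Wᗮ) :
    LocallyLipschitz fun z => f (W.graphCode (π₁ z) (π₂ z)) := by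
  have h : ContDiff ℝ 1 fun z : (V →L[ℝ] V) × Wᗮ => f (z.1, Wᗮ.subtypeL z.2 - z.1 (Wᗮ.subtypeL z.2)) :=
    hf.comp (contDiff_sub_apply Wᗮ.subtypeL)
  have h' := h.locallyLipschitz_comp_prodMk (Z := Z)
    (W.lipschitzWith_starProjection_graphOver.locallyLipschitz) π₁ π₂
  exact h'

theorem contDiff_chart_points {A B U : Type*} [NormedAddCommGroup A] [NormedSpace ℝ A]
    [NormedAddCommGroup B] [NormedSpace ℝ B] [NormedAddCommGroup U] [NormedSpace ℝ U] (q : ℕ)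
    (a : A →L[ℝ] U) (b : B →L[ℝ] U) :
    ContDiff ℝ 1 fun (z : ((A →L[ℝ] B) × B) × (Fin q → A)) (i : Fin q) =>
      b z.1.2 + (a (z.2 i) + b (z.1.1 (z.2 i))) := by
  refine contDiff_pi.2 fun i => ?_
  have h : ContDiff ℝ 1 fun z : ((A →L[ℝ] B) × B) × (Fin q → A) => z.2 i := by fun_prop
  exact (b.contDiff.comp (contDiff_snd.comp contDiff_fst)).add ((a.contDiff.comp h).add
    (b.contDiff.comp ((contDiff_fst.comp contDiff_fst).clm_apply h)))

/-- The orthogonal projection `U → W` is injective, hence bijective by dimension; `T` is its inverse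
followed by the projection to `Wᗮ`. -/
theorem exists_eq_graphOver {W U : Submodule ℝ V} (hdim : Module.finrank ℝ U = Module.finrank ℝ W)
    (hdis : ∀ x ∈ U, x ∈ Wᗮ → x = 0) : ∃ T : W →L[ℝ] Wᗮ, U = W.graphOver T := by
  let p : U →ₗ[ℝ] W := (W.orthogonalProjectionOnto : V →L[ℝ] W).toLinearMap ∘ₗ U.subtype
  have hp : ∀ x : U, p x = W.orthogonalProjectionOnto x := fun x => rfl
  have hinj : Function.Injective p := by
    rw [← LinearMap.ker_eq_bot, LinearMap.ker_eq_bot']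
    intro x hx
    rw [hp, orthogonalProjectionOnto_eq_zero_iff] at hx
    exact Subtype.ext (hdis x x.2 hx)
  let e : U ≃ₗ[ℝ] W := LinearEquiv.ofInjectiveOfFinrankEq p hinj hdim
  let T : W →ₗ[ℝ] Wᗮ := (Wᗮ.orthogonalProjectionOnto : V →L[ℝ] Wᗮ).toLinearMap ∘ₗ U.subtype ∘ₗ
    e.symm.toLinearMap
  have key : ∀ w : W, (w : V) + (T w : V) = e.symm w := by
    intro w
    have h1 : w = W.orthogonalProjectionOnto (e.symm w : V) := (e.apply_symm_apply w).symm
    have h2 := W.starProjection_add_starProjection_orthogonal (e.symm w : V)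
    rw [starProjection_apply, starProjection_apply, ← h1] at h2
    exact h2
  refine ⟨LinearMap.toContinuousLinearMap T, ?_⟩
  ext x
  rw [mem_graphOver]
  constructor
  · intro hx
    exact ⟨e ⟨x, hx⟩, by simpa using key (e ⟨x, hx⟩)⟩
  · rintro ⟨w, rfl⟩
    have := key w
    simp only [LinearMap.coe_toContinuousLinearMap'] at this ⊢
    rw [this]
    exact (e.symm w).2

theorem eq_zero_of_norm_starProjection_sub_lt_one {W U : Submodule ℝ V}
    (h : ‖U.starProjection - W.starProjection‖ < 1) {x : V} (hx : x ∈ U) (hx' : x ∈ Wᗮ) : x = 0 := by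
  by_contra hne
  have h1 := (U.starProjection - W.starProjection).le_opNorm x
  rw [sub_apply, starProjection_eq_self_iff.2 hx,
    (starProjection_apply_eq_zero_iff _).2 hx', sub_zero] at h1
  nlinarith [norm_pos_iff.2 hne]

end Submodule

/-! ### The space of planes: coordinates, compactness, charts -/

namespace AffPlane

variable {m d : ℕ}

theorem code_fst (P : AffPlane m d) : P.code.1 = P.1.direction.starProjection := rfl

theorem code_snd (P : AffPlane m d) : P.code.2 = P.foot := rfl

theorem isometry_code : Isometry (code : AffPlane m d → _) := Isometry.of_dist_eq fun _ _ => rfl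

theorem foot_mem_orthogonal (P : AffPlane m d) : P.foot ∈ P.1.directionᗮ := by
  have : Nonempty P.1 := P.2.1.to_subtype
  have h := (EuclideanGeometry.coe_orthogonalProjection_eq_iff_mem (s := P.1) (p := 0)
    (q := P.foot)).1 rfl
  simpa using h.2

/-- Expresses incidence as an equation continuous in the code and the point, so that incidence is a
closed condition. -/
theorem mem_points_iff (P : AffPlane m d) (y : EuclideanSpace ℝ (Fin m)) :
    y ∈ P.points ↔ P.code.1 y + P.code.2 = y := by
  have h0 : P.code.1 P.foot = 0 := by
    rw [code_fst]
    exact (Submodule.starProjection_apply_eq_zero_iff _).2 P.foot_mem_orthogonal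
  have h1 : y ∈ P.points ↔ y - P.foot ∈ P.1.direction :=
    (AffineSubspace.vsub_right_mem_direction_iff_mem P.foot_mem y).symm
  rw [h1, ← Submodule.starProjection_eq_self_iff, ← code_fst, map_sub, h0, sub_zero, code_snd,
    eq_sub_iff_add_eq]

theorem norm_foot_le (P : AffPlane m d) {y : EuclideanSpace ℝ (Fin m)} (hy : y ∈ P.points) :
    ‖P.foot‖ ≤ ‖y‖ := by
  have h := (P.mem_points_iff y).1 hy
  have h2 : P.foot = P.1.directionᗮ.starProjection y := by
    rw [Submodule.starProjection_orthogonal_val, ← code_fst, ← code_snd, eq_sub_iff_add_eq, add_comm]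
    exact h
  rw [h2]
  exact Submodule.norm_starProjection_apply_le _ _

theorem isClosedEmbedding_code : IsClosedEmbedding (code : AffPlane m d → _) := by
  refine ⟨isometry_code.isEmbedding, ?_⟩
  -- The codes are cut out by closed conditions; the trace of a projection records the dimension of
  -- its image.
  have hrange : range (code : AffPlane m d → _) = {z | IsIdempotentElem z.1 ∧ star z.1 = z.1 ∧
      z.1 z.2 = 0 ∧ LinearMap.trace ℝ _ z.1.toLinearMap = d} := by
    ext ⟨A, a⟩
    constructor
    · rintro ⟨P, hP⟩
      have h1 : A = P.1.direction.starProjection := congrArg Prod.fst hP.symm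
      have h2 : a = P.foot := congrArg Prod.snd hP.symm
      subst h1 h2
      refine ⟨Submodule.isIdempotentElem_starProjection _,
        (isSelfAdjoint_starProjection _).star_eq,
        (Submodule.starProjection_apply_eq_zero_iff _).2 P.foot_mem_orthogonal, ?_⟩
      rw [LinearMap.IsProj.trace (p := P.1.direction), P.2.2]
      exact ⟨fun x => Submodule.starProjection_apply_mem _ x,
        fun x hx => Submodule.starProjection_eq_self_iff.2 hx⟩
    · rintro ⟨h1, h2, h3, h4⟩
      obtain ⟨K, hK, rfl⟩ := isStarProjection_iff_eq_starProjection.1 ⟨h1, h2⟩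
      rw [LinearMap.IsProj.trace (p := K) ⟨fun x => Submodule.starProjection_apply_mem _ x,
        fun x hx => Submodule.starProjection_eq_self_iff.2 hx⟩] at h4
      let P : AffPlane m d := ⟨AffineSubspace.mk' a K, ⟨a, AffineSubspace.self_mem_mk' a K⟩, by
        rw [AffineSubspace.direction_mk']
        exact_mod_cast h4⟩
      have hdir : P.1.direction = K := AffineSubspace.direction_mk' a K
      refine ⟨P, Prod.ext ?_ ?_⟩
      · rw [code_fst]
        simp only [hdir]
      · have : Nonempty P.1 := P.2.1.to_subtype
        refine (EuclideanGeometry.coe_orthogonalProjection_eq_iff_mem (s := P.1) (p := 0)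
          (q := a)).2 ⟨AffineSubspace.self_mem_mk' a K, ?_⟩
        rw [hdir]
        simpa using (Submodule.starProjection_apply_eq_zero_iff _).1 h3
  rw [hrange]
  refine IsClosed.and ?_ (IsClosed.and ?_ (IsClosed.and ?_ ?_))
  · exact isClosed_eq (by fun_prop) (by fun_prop)
  · exact isClosed_eq (ContinuousLinearMap.adjoint.continuous.comp continuous_fst) continuous_fst
  · exact isClosed_eq (by fun_prop) (by fun_prop)
  · refine isClosed_eq ?_ continuous_const
    exact (LinearMap.continuous_of_finiteDimensional
      (LinearMap.trace ℝ (EuclideanSpace ℝ (Fin m)) ∘ₗ ContinuousLinearMap.coeLM ℝ)).comp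
        continuous_fst

theorem isCompact_setOf_norm_foot_le (R : ℝ) : IsCompact {P : AffPlane m d | ‖P.foot‖ ≤ R} := by
  have h : IsCompact (Metric.closedBall (0 : (EuclideanSpace ℝ (Fin m) →L[ℝ]
      EuclideanSpace ℝ (Fin m)) × EuclideanSpace ℝ (Fin m)) (max 1 R)) := isCompact_closedBall _ _
  refine (isClosedEmbedding_code.isCompact_preimage h).of_isClosed_subset ?_ ?_
  · exact isClosed_le (isometry_code.continuous.snd.norm) continuous_const
  · intro P hP
    rw [mem_preimage, mem_closedBall_zero_iff, Prod.norm_def]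
    exact max_le ((Submodule.starProjection_norm_le _).trans (le_max_left _ _))
      (le_trans hP (le_max_right _ _))

/-- A plane whose direction is a graph over `W` meets `Wᗮ` in one point `b`. Then `(T, b)` are
coordinates of the plane and `w` is a coordinate on it. -/
theorem exists_graphCode {W : Submodule ℝ (EuclideanSpace ℝ (Fin m))} (P : AffPlane m d)
    {T : W →L[ℝ] Wᗮ} (hT : P.1.direction = W.graphOver T) :
    ∃ b : Wᗮ, P.code = W.graphCode T b ∧
      ∀ y ∈ P.points, ∃ w : W, (b : EuclideanSpace ℝ (Fin m)) + (w + (T w : _)) = y := by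
  set f := P.foot with hf
  let w₀ : W := W.orthogonalProjectionOnto f
  let b : Wᗮ := Wᗮ.orthogonalProjectionOnto f - T w₀
  have hb : (b : EuclideanSpace ℝ (Fin m)) = f - (w₀ + (T w₀ : _)) := by
    have := W.starProjection_add_starProjection_orthogonal f
    rw [Submodule.starProjection_apply, Submodule.starProjection_apply] at this
    conv_rhs => rw [← this]
    simp only [b, w₀, Submodule.coe_sub]
    abel
  have hw₀ : (w₀ : EuclideanSpace ℝ (Fin m)) + (T w₀ : _) ∈ W.graphOver T :=
    Submodule.mem_graphOver.2 ⟨w₀, rfl⟩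
  refine ⟨b, Prod.ext ?_ ?_, fun y hy => ?_⟩
  · rw [code_fst]
    simp only [hT, Submodule.graphCode]
  · have h1 : (W.graphOver T).starProjection f = 0 :=
      (Submodule.starProjection_apply_eq_zero_iff _).2 (hT ▸ P.foot_mem_orthogonal)
    rw [code_snd, ← hf]
    simp only [Submodule.graphCode]
    rw [hb, map_sub, h1, Submodule.starProjection_eq_self_iff.2 hw₀]
    abel
  · have h1 : y - f ∈ W.graphOver T := by
      rw [← hT]
      exact (AffineSubspace.vsub_right_mem_direction_iff_mem P.foot_mem y).2 hy
    obtain ⟨w, hw⟩ := Submodule.mem_graphOver.1 (add_mem h1 hw₀)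
    refine ⟨w, ?_⟩
    rw [hw, hb]
    abel

/-- Every direction at projection distance less than `1` from `W`, of the same dimension, is a graph
over `W`; so the directions of a countable dense set of planes suffice. -/
theorem exists_countable_charts (m d : ℕ) :
    ∃ S : Set (Submodule ℝ (EuclideanSpace ℝ (Fin m))), S.Countable ∧
      (∀ W ∈ S, Module.finrank ℝ W = d) ∧
      ∀ P : AffPlane m d, ∃ W ∈ S, ∃ T : W →L[ℝ] Wᗮ, P.1.direction = W.graphOver T := by
  have := isometry_code (m := m) (d := d) |>.isEmbedding.secondCountableTopology
  obtain ⟨D, hDc, hD⟩ := TopologicalSpace.exists_countable_dense (AffPlane m d)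
  refine ⟨(fun P => P.1.direction) '' D, hDc.image _, ?_, fun P => ?_⟩
  · rintro _ ⟨P, -, rfl⟩
    exact P.2.2
  · obtain ⟨P', hP', hdist⟩ := hD.exists_dist_lt P one_pos
    refine ⟨_, ⟨P', hP', rfl⟩, Submodule.exists_eq_graphOver (P.2.2.trans P'.2.2.symm)
      fun x hx hx' => Submodule.eq_zero_of_norm_starProjection_sub_lt_one ?_ hx hx'⟩
    rw [← dist_eq_norm]
    exact (le_max_left _ _).trans_lt hdist

end AffPlane

/-! ### The dimension count for incidences with planes -/

namespace Submodule

variable {V : Type*} [NormedAddCommGroup V] [InnerProductSpace ℝ V] [FiniteDimensional ℝ V]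

theorem locallyLipschitz_chart_value {C : Type*} [NormedAddCommGroup C]
    [NormedSpace ℝ C] {f : (V →L[ℝ] V) × V → C}
    (hf : ContDiff ℝ 1 f) (W : Submodule ℝ V) (q : ℕ) :
    LocallyLipschitz fun (z : ((W →L[ℝ] Wᗮ) × Wᗮ) × (Fin q → W)) => f (W.graphCode z.1.1 z.1.2) := by
  have h := hf.locallyLipschitz_comp_graphCode W (Z := ((W →L[ℝ] Wᗮ) × Wᗮ) × (Fin q → W))
        ((ContinuousLinearMap.fst ℝ (W →L[ℝ] Wᗮ) Wᗮ).comp (ContinuousLinearMap.fst ℝ _ (Fin q → W)))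
        ((ContinuousLinearMap.snd ℝ (W →L[ℝ] Wᗮ) Wᗮ).comp (ContinuousLinearMap.fst ℝ _ (Fin q → W)))
  exact h

/-- The parameters are `T`, the base point `b`, and the coordinates in `W` of the `q` points on the
plane: `dc + c + qd` in number if `W` has dimension `d` and codimension `c`. -/
theorem dimH_incidenceSet_graphOver_le {ι C : Type*} [Fintype ι] [NormedAddCommGroup C]
    [NormedSpace ℝ C] {f : (V →L[ℝ] V) × V → C} (hf : ContDiff ℝ 1 f) (W : Submodule ℝ V)
    {q n D : ℕ} (hD : Module.finrank ℝ W * Module.finrank ℝ Wᗮ + Module.finrank ℝ Wᗮ +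
      q * Module.finrank ℝ W + q * n + Fintype.card ι * Module.finrank ℝ V
        ≤ D + q * Module.finrank ℝ V) :
    dimH (incidenceSet ι n
      (fun (z : ((W →L[ℝ] Wᗮ) × Wᗮ) × (Fin q → W)) (i : Fin q) =>
        (z.1.2 : V) + ((z.2 i : V) + (z.1.1 (z.2 i) : V)))
      fun z => f (W.graphCode z.1.1 z.1.2)) ≤ D := by
  have h4 : Module.finrank ℝ (W →L[ℝ] Wᗮ) = Module.finrank ℝ W * Module.finrank ℝ Wᗮ := by
    rw [← (LinearMap.toContinuousLinearMap (𝕜 := ℝ) (E := W) (F' := Wᗮ)).finrank_eq,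
      Module.finrank_linearMap]
  refine dimH_incidenceSet_le ?_ (locallyLipschitz_chart_value hf W q) ?_
  · exact (contDiff_chart_points q W.subtypeL Wᗮ.subtypeL).locallyLipschitz
  · rw [Module.finrank_prod, Module.finrank_prod, Module.finrank_pi_fintype, h4]
    simpa using hD

end Submodule

/-- All `k ≤ -1` mean that `Y` is empty, so `k` may be raised to `-1` and written as `r - 1` with
`r` natural. -/
theorem coveringDimLE_iff_toNat {Y : Type*} [TopologicalSpace Y] {k : ℤ} :
    CoveringDimLE Y k ↔ CoveringDimLE Y (((k + 1).toNat : ℤ) - 1) := by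
  rcases le_or_gt (-1) k with hk | hk
  · have : (((k + 1).toNat : ℤ) - 1) = k := by omega
    rw [this]
  · have h0 : (((k + 1).toNat : ℤ) - 1) + 1 = 0 := by omega
    constructor
    · intro h 𝒰 h1 h2 h3
      obtain ⟨𝒱, h4, h5, h6, h7, h8⟩ := h 𝒰 h1 h2 h3
      exact ⟨𝒱, h4, h5, h6, h7, fun y => (h8 y).trans (by omega)⟩
    · intro h 𝒰 h1 h2 h3
      obtain ⟨𝒱, h4, h5, h6, h7, h8⟩ := h 𝒰 h1 h2 h3
      refine ⟨𝒱, h4, h5, h6, h7, fun y => ?_⟩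
      exfalso
      obtain ⟨V, hV, hy⟩ := mem_sUnion.1 (h6 ▸ mem_univ y : y ∈ ⋃₀ 𝒱)
      have h9 : 0 < {V ∈ 𝒱 | y ∈ V}.ncard :=
        (ncard_pos (h4.subset (sep_subset _ _))).2 ⟨V, hV, hy⟩
      have := h8 y
      omega

/-! ### Separated planes; openness and density of the avoiding maps -/

/-- The planes meeting the images of `q` points with mutual distances at least `ε`. -/
def separatedPlanes {X : Type*} [MetricSpace X] (q d m : ℕ) (ε : ℝ)
    (g : C(X, EuclideanSpace ℝ (Fin m))) : Set (AffPlane m d) :=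
  {P | ∃ x : Fin q → X, (∀ i j, i ≠ j → ε ≤ dist (x i) (x j)) ∧ ∀ i, g (x i) ∈ P.points}

section

variable {X : Type*} [MetricSpace X] {q d m : ℕ}

theorem planesMeeting_eq_iUnion (g : C(X, EuclideanSpace ℝ (Fin m))) :
    planesMeeting q d m g = ⋃ j : ℕ, separatedPlanes q d m (1 / (j + 1)) g := by
  ext P
  simp only [mem_iUnion]
  constructor
  · intro hP
    obtain ⟨t, ht, hcard⟩ := Set.exists_subset_encard_eq (show (q : ℕ∞) ≤ _ from hP)
    have hfin : t.Finite := finite_of_encard_eq_coe hcard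
    lift t to Finset X using hfin
    rw [encard_coe_eq_coe_finsetCard, Nat.cast_inj] at hcard
    let x : Fin q → X := fun i => (t.equivFinOfCardEq hcard).symm i
    have hx : Function.Injective x :=
      Subtype.val_injective.comp (t.equivFinOfCardEq hcard).symm.injective
    have h1 : ∀ᶠ j : ℕ in Filter.atTop, ∀ p : Fin q × Fin q, p.1 ≠ p.2 →
        1 / ((j : ℝ) + 1) ≤ dist (x p.1) (x p.2) := by
      refine Filter.eventually_all.2 fun p => ?_
      by_cases hp : p.1 = p.2
      · exact Filter.Eventually.of_forall fun j h => absurd hp h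
      · have h2 : 0 < dist (x p.1) (x p.2) := dist_pos.2 (hx.ne hp)
        filter_upwards [(tendsto_one_div_add_atTop_nhds_zero_nat (𝕜 := ℝ)).eventually_lt_const h2]
          with j hj _ using hj.le
    obtain ⟨j, hj⟩ := h1.exists
    exact ⟨j, x, fun i i' h => hj (i, i') h, fun i => ht ((t.equivFinOfCardEq hcard).symm i).2⟩
  · rintro ⟨j, x, hx, hxP⟩
    have hinj : Function.Injective x := by
      intro i i' h
      by_contra hne
      have h1 := hx i i' hne
      rw [h, dist_self] at h1
      exact absurd h1 (not_le.2 (by positivity))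
    have h2 : (range x).encard = q := by
      rw [← image_univ, hinj.encard_image, encard_univ]
      simp
    change (q : ℕ∞) ≤ _
    rw [← h2]
    exact encard_le_encard (range_subset_iff.2 hxP)

variable [CompactSpace X]

theorem norm_foot_le_of_mem_separatedPlanes (hq : 1 ≤ q) {ε : ℝ}
    {g : C(X, EuclideanSpace ℝ (Fin m))} {P : AffPlane m d} (hP : P ∈ separatedPlanes q d m ε g) :
    ‖P.foot‖ ≤ ‖g‖ := by
  obtain ⟨x, -, hx⟩ := hP
  exact (P.norm_foot_le (hx ⟨0, hq⟩)).trans (g.norm_coe_le_norm _)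

theorem isClosed_separated_incidence (ε : ℝ) :
    IsClosed {z : C(X, EuclideanSpace ℝ (Fin m)) × (Fin q → X) × AffPlane m d |
      (∀ i j, i ≠ j → ε ≤ dist (z.2.1 i) (z.2.1 j)) ∧ ∀ i, z.1 (z.2.1 i) ∈ z.2.2.points} := by
  have hcode : Continuous (AffPlane.code : AffPlane m d → _) := AffPlane.isometry_code.continuous
  have hev : ∀ i, Continuous fun z : C(X, EuclideanSpace ℝ (Fin m)) × (Fin q → X) × AffPlane m d =>
      z.1 (z.2.1 i) := fun i => by fun_prop
  have hc : Continuous fun z : C(X, EuclideanSpace ℝ (Fin m)) × (Fin q → X) × AffPlane m d =>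
      z.2.2.code := by fun_prop
  simp only [AffPlane.mem_points_iff, Set.ofPred_and, Set.ofPred_forall]
  refine IsClosed.inter ?_ ?_
  · exact isClosed_iInter fun i => isClosed_iInter fun j => isClosed_iInter fun _ =>
      isClosed_le (by fun_prop) (by fun_prop)
  · exact isClosed_iInter fun i => isClosed_eq ((hc.fst.clm_apply (hev i)).add hc.snd) (hev i)

theorem isCompact_separatedPlanes (hq : 1 ≤ q) (ε : ℝ) (g : C(X, EuclideanSpace ℝ (Fin m))) :
    IsCompact (separatedPlanes q d m ε g) := by
  have h1 : IsCompact ((univ : Set (Fin q → X)) ×ˢ {P : AffPlane m d | ‖P.foot‖ ≤ ‖g‖}) :=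
    isCompact_univ.prod (AffPlane.isCompact_setOf_norm_foot_le _)
  have h2 := (h1.inter_right ((isClosed_separated_incidence (q := q) (d := d) ε).preimage
    (Continuous.prodMk_right g))).image continuous_snd
  convert h2 using 1
  ext P
  constructor
  · intro hP
    have h3 := norm_foot_le_of_mem_separatedPlanes hq hP
    obtain ⟨x, hx⟩ := hP
    exact ⟨(x, P), ⟨⟨mem_univ _, h3⟩, hx⟩, rfl⟩
  · rintro ⟨⟨x, P⟩, ⟨-, hx⟩, rfl⟩
    exact ⟨x, hx⟩

/-- A tube lemma argument: incidence is closed, and for `g` near `g₀` all separated planes have foot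
of norm at most `‖g₀‖ + 1`, hence lie in one compact set. -/
theorem isOpen_setOf_separatedPlanes_subset (hq : 1 ≤ q) (ε : ℝ) {Ω : Set (AffPlane m d)}
    (hΩ : IsOpen Ω) :
    IsOpen {g : C(X, EuclideanSpace ℝ (Fin m)) | separatedPlanes q d m ε g ⊆ Ω} := by
  rw [isOpen_iff_mem_nhds]
  intro g₀ hg₀
  have hK : IsCompact ((univ : Set (Fin q → X)) ×ˢ {P : AffPlane m d | ‖P.foot‖ ≤ ‖g₀‖ + 1}) :=
    isCompact_univ.prod (AffPlane.isCompact_setOf_norm_foot_le _)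
  have h1 := hK.eventually_forall_of_forall_eventually (x₀ := g₀)
    (P := fun g y => (∀ i j, i ≠ j → ε ≤ dist (y.1 i) (y.1 j)) ∧ (∀ i, g (y.1 i) ∈ y.2.points) →
      y.2 ∈ Ω) ?_
  · have h2 : ∀ᶠ g : C(X, EuclideanSpace ℝ (Fin m)) in 𝓝 g₀, ‖g‖ < ‖g₀‖ + 1 :=
      continuous_norm.continuousAt.eventually_lt_const (lt_add_one _)
    filter_upwards [h1, h2] with g hg hg' P hP
    have h3 := norm_foot_le_of_mem_separatedPlanes hq hP
    obtain ⟨x, hx⟩ := hP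
    exact hg (x, P) ⟨mem_univ _, h3.trans hg'.le⟩ hx
  · rintro ⟨x, P⟩ -
    by_cases hP : P ∈ Ω
    · have h2 : ∀ᶠ z : C(X, EuclideanSpace ℝ (Fin m)) × (Fin q → X) × AffPlane m d in
          𝓝 (g₀, (x, P)), z.2.2 ∈ Ω :=
        (continuous_snd.snd.continuousAt).eventually_mem (hΩ.mem_nhds hP)
      exact h2.mono fun z hz _ => hz
    · have h2 := (isClosed_separated_incidence (X := X) (q := q) (d := d) (m := m)
        ε).isOpen_compl.mem_nhds (x := (g₀, (x, P))) fun h => hP (hg₀ ⟨x, h⟩)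
      exact Filter.mem_of_superset h2 fun z hz h => absurd h hz

/-- The maps `g` such that `F` is `δ`-close, on the codes of the separated planes of `g`, to a map
without zeros there. -/
def avoidingMaps (X : Type*) [MetricSpace X] (q d : ℕ) {m r : ℕ} (ε δ : ℝ)
    (F : C((EuclideanSpace ℝ (Fin m) →L[ℝ] EuclideanSpace ℝ (Fin m)) × EuclideanSpace ℝ (Fin m),
      Fin r → ℝ)) : Set C(X, EuclideanSpace ℝ (Fin m)) :=
  {g | ∃ f' : C(AffPlane m d, Fin r → ℝ), ∀ P ∈ separatedPlanes q d m ε g,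
    dist (f' P) (F P.code) < δ ∧ f' P ≠ 0}

variable {r : ℕ}

theorem isOpen_avoidingMaps (hq : 1 ≤ q) (ε δ : ℝ)
    (F : C((EuclideanSpace ℝ (Fin m) →L[ℝ] EuclideanSpace ℝ (Fin m)) × EuclideanSpace ℝ (Fin m),
      Fin r → ℝ)) : IsOpen (avoidingMaps X q d ε δ F) := by
  have hcode : Continuous (AffPlane.code : AffPlane m d → _) := AffPlane.isometry_code.continuous
  have h : avoidingMaps X q d ε δ F = ⋃ f' : C(AffPlane m d, Fin r → ℝ),
      {g | separatedPlanes q d m ε g ⊆ {P | dist (f' P) (F P.code) < δ ∧ f' P ≠ 0}} := by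
    ext g
    simp only [mem_iUnion]
    rfl
  rw [h]
  refine isOpen_iUnion fun f' => isOpen_setOf_separatedPlanes_subset hq ε ?_
  have h1 : IsOpen {P | dist (f' P) (F P.code) < δ} :=
    isOpen_lt (f'.continuous.dist (F.continuous.comp hcode)) continuous_const
  have h2 : IsOpen {P | f' P ≠ 0} := isOpen_ne_fun f'.continuous continuous_const
  exact h1.inter h2

theorem dense_avoidingMaps {n c : ℕ} (hX : CoveringDimLE X (n : ℤ)) (hq : 1 ≤ q) (hm : d + c = m)
    (hdim : d * c + c + q * d + q * n < q * m + r) {ε δ : ℝ} (hε : 0 < ε) (hδ : 0 < δ)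
    (F : C((EuclideanSpace ℝ (Fin m) →L[ℝ] EuclideanSpace ℝ (Fin m)) × EuclideanSpace ℝ (Fin m),
      Fin r → ℝ)) : Dense (avoidingMaps X q d ε δ F) := by
  classical
  rw [Metric.dense_iff]
  intro g₀ η hη
  rcases isEmpty_or_nonempty X with hXe | hXn
  · exact ⟨g₀, Metric.mem_ball_self hη, 0, fun P ⟨x, _⟩ => isEmptyElim (x ⟨0, hq⟩)⟩
  -- Radius `ε / 2` ensures that points at distance at least `ε` have no `φ i` nonzero at both, so
  -- their simplices share no vertex.
  let U : X → Set X := fun x => Metric.ball x (ε / 2) ∩ g₀ ⁻¹' Metric.ball (g₀ x) (η / 2)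
  have hUo : ∀ x, IsOpen (U x) := fun x =>
    Metric.isOpen_ball.inter (Metric.isOpen_ball.preimage g₀.continuous)
  obtain ⟨t, -, ht⟩ := isCompact_univ.elim_nhds_subcover U fun x _ => (hUo x).mem_nhds
    ⟨Metric.mem_ball_self (half_pos hε), Metric.mem_ball_self (half_pos hη)⟩
  obtain ⟨𝒱, φ, hφ0, hφ1, hφU, hφr⟩ := CoveringDimLE.exists_partition (r := n + 1)
    (by simpa using hX) (t.finite_toSet.image U) (by rintro _ ⟨x, -, rfl⟩; exact hUo x)
    (by
      refine eq_univ_of_forall fun y => ?_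
      obtain ⟨x, hx, hy⟩ := mem_iUnion₂.1 (ht (mem_univ y))
      exact ⟨_, ⟨x, hx, rfl⟩, hy⟩)
  have hbase : ∀ i, ∃ x, ∀ y, φ i y ≠ 0 → y ∈ U x := fun i => by
    obtain ⟨_, ⟨x, -, rfl⟩, h⟩ := hφU i
    exact ⟨x, h⟩
  choose a ha using hbase
  have hsum : ∀ y, ∑ i with φ i y ≠ 0, φ i y = 1 := fun y => by
    rw [Finset.sum_filter_ne_zero, hφ1]
  -- Smoothness makes the value `f` of the code locally Lipschitz in chart parameters, as the
  -- dimension count requires.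
  obtain ⟨f, hf, hfF, -⟩ := F.continuous.exists_contDiff_approx 1 (ε := fun _ => δ / 2)
    continuous_const (fun _ => half_pos hδ)
  obtain ⟨S, hSc, hSd, hS⟩ := AffPlane.exists_countable_charts m d
  have := hSc.to_subtype
  let p : ∀ W : S, ((W.1 →L[ℝ] W.1ᗮ) × W.1ᗮ) × (Fin q → W.1) → Fin q → EuclideanSpace ℝ (Fin m) :=
    fun W z i => (z.1.2 : EuclideanSpace ℝ (Fin m)) + (z.2 i + (z.1.1 (z.2 i) : _))
  let h : ∀ W : S, ((W.1 →L[ℝ] W.1ᗮ) × W.1ᗮ) × (Fin q → W.1) → Fin r → ℝ :=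
    fun W z => f (W.1.graphCode z.1.1 z.1.2)
  have hN : 0 < Fintype.card 𝒱 := by
    obtain ⟨y⟩ := hXn
    refine Fintype.card_pos_iff.2 (not_isEmpty_iff.1 fun he => ?_)
    have := hφ1 y
    simp at this
  -- Keeps the truncated subtraction in the next bound honest.
  have hpos : 0 < Fintype.card 𝒱 * m + r := by
    by_contra h0
    have hr : r = 0 := by omega
    have hm0 : m = 0 := by
      rcases Nat.mul_eq_zero.1 (by omega : Fintype.card 𝒱 * m = 0) with h | h <;> omega
    subst hr hm0
    simp at hdim
  have hdimH : dimH (⋃ W : S, incidenceSet 𝒱 n (p W) (h W)) ≤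
      (Fintype.card 𝒱 * m + r - 1 : ℕ) := by
    rw [dimH_iUnion]
    refine iSup_le fun W => Submodule.dimH_incidenceSet_graphOver_le hf W.1 ?_
    have h1 := hSd W.1 W.2
    have h2 := W.1.finrank_add_finrank_orthogonal
    rw [finrank_euclideanSpace_fin, h1] at h2
    have h3 : Module.finrank ℝ W.1ᗮ = c := by omega
    rw [finrank_euclideanSpace_fin, h1, h3]
    omega
  have hdense : Dense (⋃ W : S, incidenceSet 𝒱 n (p W) (h W))ᶜ := by
    refine dense_compl_of_dimH_lt_finrank (hdimH.trans_lt ?_)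
    have h1 : Module.finrank ℝ ((𝒱 → EuclideanSpace ℝ (Fin m)) × (Fin r → ℝ))
        = Fintype.card 𝒱 * m + r := by
      simp [Module.finrank_prod, Module.finrank_pi_fintype]
    rw [h1, Nat.cast_lt]
    omega
  -- The vertices and the regular value `b` are chosen together: `g` will use `v`, and `f - b` will
  -- be the zero-free map.
  obtain ⟨⟨v, b⟩, hvb, hdist⟩ := hdense.exists_dist_lt (fun i => g₀ (a i), 0)
    (lt_min (half_pos hη) (half_pos hδ))
  have hv : ∀ i, dist (v i) (g₀ (a i)) < η / 2 := fun i => by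
    rw [dist_comm]
    exact ((dist_le_pi_dist (fun i => g₀ (a i)) v i).trans (le_max_left _ _)).trans_lt
      (hdist.trans_le (min_le_left _ _))
  have hb : dist 0 b < δ / 2 := (le_max_right _ _).trans_lt (hdist.trans_le (min_le_right _ _))
  let g : C(X, EuclideanSpace ℝ (Fin m)) := ⟨fun y => ∑ i, φ i y • v i, by fun_prop⟩
  have hg : ∀ y, g y = ∑ i with φ i y ≠ 0, φ i y • v i := fun y =>
    (Finset.sum_filter_of_ne fun i _ h => left_ne_zero_of_smul h).symm
  refine ⟨g, ?_, ⟨fun P => f P.code - b, ?_⟩, ?_⟩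
  · rw [Metric.mem_ball, ContinuousMap.dist_lt_iff hη]
    intro y
    rw [hg, ← Metric.mem_ball]
    refine (convex_ball (g₀ y) η).sum_mem (fun i _ => hφ0 i y) (hsum y) fun i hi => ?_
    have h1 : dist (g₀ y) (g₀ (a i)) < η / 2 := (ha i y (Finset.mem_filter.1 hi).2).2
    have := dist_triangle_right (v i) (g₀ y) (g₀ (a i))
    have := hv i
    rw [Metric.mem_ball]
    linarith
  · exact (hf.continuous.comp AffPlane.isometry_code.continuous).sub continuous_const
  · rintro P ⟨x, hx, hxP⟩
    refine ⟨?_, fun h0 => hvb ?_⟩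
    · change dist (f P.code - b) (F P.code) < δ
      have h1 := hfF P.code
      have h2 := dist_triangle (f P.code - b) (f P.code) (F P.code)
      have h3 : dist (f P.code - b) (f P.code) = dist 0 b := by simp [dist_eq_norm]
      linarith
    · obtain ⟨W, hW, T, hT⟩ := hS P
      obtain ⟨e, he, hy⟩ := AffPlane.exists_graphCode P hT
      choose w hw using fun i => hy _ (hxP i)
      refine mem_iUnion.2 ⟨⟨W, hW⟩, ((T, e), w), ?_, fun i => {j | φ j (x i) ≠ 0},
        fun i j => φ j (x i), fun i i' hne => ?_, fun i => ?_, fun i => hsum (x i), fun i => ?_⟩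
      · change f (W.graphCode T e) = b
        rw [← he]
        exact sub_eq_zero.1 h0
      · rw [Finset.disjoint_left]
        intro j hj hj'
        have h1 : dist (x i) (a j) < ε / 2 := (ha j _ (Finset.mem_filter.1 hj).2).1
        have h2 : dist (x i') (a j) < ε / 2 := (ha j _ (Finset.mem_filter.1 hj').2).1
        have h3 := hx i i' hne
        have := dist_triangle_right (x i) (x i') (a j)
        linarith
      · exact hφr (x i) _ fun j hj => (Finset.mem_filter.1 hj).2
      · exact (hg (x i)).symm.trans (hw i).symm

end

/-! ### The Baire category argument and the four cases -/

theorem mapsH_eq_iInter {X : Type*} [MetricSpace X] [CompactSpace X] {q d m r : ℕ} (hq : 1 ≤ q)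
    {D : Set C((EuclideanSpace ℝ (Fin m) →L[ℝ] EuclideanSpace ℝ (Fin m)) × EuclideanSpace ℝ (Fin m),
      Fin r → ℝ)} (hD : Dense D) :
    mapsH X q d m ((r : ℤ) - 1) =
      ⋂ a : ℕ × ℕ × D, avoidingMaps X q d (1 / ((a.1 : ℝ) + 1)) (1 / ((a.2.1 : ℝ) + 1)) a.2.2.1 := by
  have hcode : Continuous (AffPlane.code : AffPlane m d → _) := AffPlane.isometry_code.continuous
  ext g
  simp only [mem_iInter]
  have hK : ∀ j : ℕ, IsCompact (separatedPlanes q d m (1 / ((j : ℝ) + 1)) g) :=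
    fun j => isCompact_separatedPlanes hq _ g
  have hsub : ∀ j : ℕ, separatedPlanes q d m (1 / ((j : ℝ) + 1)) g ⊆ planesMeeting q d m g :=
    fun j => by
      rw [planesMeeting_eq_iUnion]
      exact subset_iUnion (fun j : ℕ => separatedPlanes q d m (1 / ((j : ℝ) + 1)) g) j
  constructor
  · rintro hg ⟨j, l, F⟩
    obtain ⟨f', hf'⟩ := CoveringDimLE.genericallyAvoids hg (hK j) (hsub j)
      (F.1.comp ⟨AffPlane.code, hcode⟩) (1 / ((l : ℝ) + 1)) (by positivity)
    exact ⟨f', hf'⟩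
  · intro hg
    refine coveringDimLE_of_genericallyAvoids
      (fun j : ℕ => Subtype.val ⁻¹' separatedPlanes q d m (1 / ((j : ℝ) + 1)) g) (fun j => ?_) ?_
      fun j => ?_
    · rw [Topology.IsInducing.subtypeVal.isCompact_preimage_iff (by simpa using hsub j)]
      exact hK j
    · refine eq_univ_of_forall fun P => ?_
      obtain ⟨j, hj⟩ := mem_iUnion.1 ((planesMeeting_eq_iUnion g).subset P.2)
      exact mem_iUnion.2 ⟨j, hj⟩
    · refine GenericallyAvoids.preimage_val (fun f δ hδ => ?_) (hK j) (hsub j)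
      -- A test map on planes extends to the linear space of codes by Tietze, where a member of `D`
      -- approximates it uniformly on the compact set of codes of separated planes.
      obtain ⟨F, hF⟩ := f.exists_extension AffPlane.isClosedEmbedding_code
      have hF' : ∀ P : AffPlane m d, F P.code = f P := fun P => congrArg (fun e => e P) hF
      obtain ⟨l, hl⟩ := exists_nat_one_div_lt (half_pos hδ)
      have h1 : ∀ᶠ F₁ in 𝓝 F, ∀ z ∈ AffPlane.code '' separatedPlanes q d m (1 / ((j : ℝ) + 1)) g,
          dist (F z) (F₁ z) < δ / 2 :=
        Metric.tendstoUniformlyOn_iff.1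
          (ContinuousMap.tendsto_iff_forall_isCompact_tendstoUniformlyOn.1 Filter.tendsto_id _
            ((hK j).image hcode)) (δ / 2) (half_pos hδ)
      obtain ⟨F₁, hF₁, hF₁D⟩ := (hD.inter_nhds_nonempty h1)
      obtain ⟨f', hf'⟩ := hg (j, l, ⟨F₁, hF₁⟩)
      refine ⟨f', fun P hP => ⟨?_, (hf' P hP).2⟩⟩
      have h2 := (hf' P hP).1
      have h3 := hF₁D P.code ⟨P, hP, rfl⟩
      rw [hF'] at h3
      have := dist_triangle_right (f' P) (f P) (F₁ P.code)
      simp only at h2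
      linarith

theorem dense_isGδ_mapsH {X : Type*} [TopologicalSpace X] [CompactSpace X]
    [TopologicalSpace.MetrizableSpace X] {n q d c m : ℕ} {k : ℤ} (hX : CoveringDimLE X (n : ℤ))
    (hq : 1 ≤ q) (hm : d + c = m)
    (hk : (d + 1) * (c : ℤ) + q * ((n : ℤ) - c) = k) :
    Dense (mapsH X q d m k) ∧ IsGδ (mapsH X q d m k) := by
  let _ := TopologicalSpace.metrizableSpaceMetric X
  have hmaps : mapsH X q d m k = mapsH X q d m (((k + 1).toNat : ℤ) - 1) :=
    Set.ext fun g => coveringDimLE_iff_toNat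
  -- With `m = d + c` this reads `(d+1)c + q(n-c) < r`, that is `k < r`, for `r = (k + 1).toNat`.
  have hdim : d * c + c + q * d + q * n < q * m + (k + 1).toNat := by
    have h1 := Int.self_le_toNat (k + 1)
    subst hm
    zify
    nlinarith
  obtain ⟨D, hDc, hD⟩ := TopologicalSpace.exists_countable_dense
    C((EuclideanSpace ℝ (Fin m) →L[ℝ] EuclideanSpace ℝ (Fin m)) × EuclideanSpace ℝ (Fin m),
      Fin (k + 1).toNat → ℝ)
  have := hDc.to_subtype
  rw [hmaps, mapsH_eq_iInter hq hD]
  have hopen : ∀ a : ℕ × ℕ × D, IsOpen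
      (avoidingMaps X q d (1 / ((a.1 : ℝ) + 1)) (1 / ((a.2.1 : ℝ) + 1)) a.2.2.1) :=
    fun a => isOpen_avoidingMaps hq _ _ _
  refine ⟨dense_iInter_of_isOpen hopen fun a => ?_, IsGδ.iInter_of_isOpen hopen⟩
  exact dense_avoidingMaps hX hq hm hdim (by positivity) (by positivity) _

theorem theorem1p1 (X : Type*) [TopologicalSpace X] [CompactSpace X]
    [TopologicalSpace.MetrizableSpace X] (n : ℕ) (hX : CoveringDimLE X (n : ℤ)) :
    (∀ m : ℕ, 2 * n + 1 ≤ m →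
      Dense (mapsH X 3 1 m (3 * (n : ℤ) + 1 - (m : ℤ))) ∧
        IsGδ (mapsH X 3 1 m (3 * (n : ℤ) + 1 - (m : ℤ)))) ∧
    (∀ m : ℕ, 2 * n + 1 ≤ m →
      Dense (mapsH X 2 1 m (2 * (n : ℤ))) ∧ IsGδ (mapsH X 2 1 m (2 * (n : ℤ)))) ∧
    (∀ m d : ℕ, n + d ≤ m →
      Dense (mapsH X 1 d m ((n : ℤ) + (d : ℤ) * ((m : ℤ) - (d : ℤ)))) ∧
        IsGδ (mapsH X 1 d m ((n : ℤ) + (d : ℤ) * ((m : ℤ) - (d : ℤ))))) ∧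
    (n = 1 → Dense (mapsH X 4 1 3 0) ∧ IsGδ (mapsH X 4 1 3 0)) := by
  refine ⟨fun m hm => ?_, fun m hm => ?_, fun m d hm => ?_, fun hn => ?_⟩
  · obtain ⟨c, rfl⟩ := Nat.exists_eq_add_of_le (show 1 ≤ m by omega)
    exact dense_isGδ_mapsH hX (by norm_num) rfl (by push_cast; ring)
  · obtain ⟨c, rfl⟩ := Nat.exists_eq_add_of_le (show 1 ≤ m by omega)
    exact dense_isGδ_mapsH hX (by norm_num) rfl (by push_cast; ring)
  · obtain ⟨c, rfl⟩ := Nat.exists_eq_add_of_le (show d ≤ m by omega)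
    exact dense_isGδ_mapsH hX le_rfl rfl (by push_cast; ring)
  · subst hn
    exact dense_isGδ_mapsH (c := 2) hX (by norm_num) rfl (by norm_num)
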